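/- Let $N\ge 1$ and $K>N$ be integers. A server holds $N$ files $W_1,\dots,W_N$, independent and uniformly distributed on $[1:2^F]$; there are $K$ users, and user $k$ demands the file $W_{d_k}$, $d_k\in[1:N]$. For $M,R\ge 0$, an $(M,R,F)$ code consists of caching functions $\phi_k:[1:2^F]^N\to[1:2^{\lfloor FM\rfloor}]$ giving $Z_k=\phi_k(W_1,\dots,W_N)$, a delivery function $\psi:[1:2^F]^N\times[1:N]^K\to[1:2^{\lfloor FR\rfloor}]$ giving $X=\psi(W_1,\dots,W_N,d_1,\dots,d_K)$, and decoding functions $\mu_k:[1:2^{\lfloor FM\rfloor}]\times[1:2^{\lfloor FR\rfloor}]\times[1:N]^K\to[1:2^F]$ ($k\in[1:K]$). Its error probability is $P_e=\max_{d\in[1:N]^K}\Pr\{\exists k:\ \mu_k(Z_k,X,d)\ne W_{d_k}\}$. The pair $(M,R)$ is achievable if for every $\varepsilon>0$ there are $(M,R,F)$ codes with arbitrarily large $F$ and $P_e<\varepsilon$. Let $$f(N,K,t)=\frac{(N-1)(K-t)}{(t+1)(tN-1)}+N^2\Big(1-\frac1K\Big)\frac{t-1}{tN-1},$$ let $t^*$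 be any minimizer of $f(N,K,t)$ over $t\in[1:K]$ (over $t\in[2:K]$ if $N=1$, where $f(1,K,1)$ is undefined), and let $\hat t=\max\{2,t^*\}$. For $1/K\le M\le \hat tN/K$ put $$R^{\rm C}_{\rm GBC}(M)=\begin{cases} N\left(1-\frac M2-\frac1{2K}\right), & \frac1K\le M\le \frac NK,\\[4pt] \frac{K-\hat t}{\hat t^2-1}\left(\frac{KM}{N}-1\right)+\frac{K-(N+1)/2}{\hat t-1}\left(\frac{\hat tN}{K}-M\right), & \frac NK\le M\le\frac{\hat tN}{K}.\end{cases}$$ Then the delivery rate–cache capacity trade-off $R^{\rm C}_{\rm GBC}$ is achievable on $[1/K,\hat tN/K]$: for every rational $M$ in this interval the pair $(M,R^{\rm C}_{\rm GBC}(M))$ is achievable, and for every real $M$ in this interval every pair $(M,R)$ with $R>R^{\rm C}_{\rm GBC}(M)$ is achievable (so the infimum of the achievable rates at cache capacity $M$ is at most $R^{\rm C}_{\rm GBC}(M)$). -/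

import Mathlib

namespace CodedCaching

/-- The database: `N` files, each one of the `2 ^ F` binary words of length `F`. -/
abbrev Database (N F : ℕ) : Type := Fin N → Fin (2 ^ F)

/-- A demand vector: user `k` requests the file with index `d k`. -/
abbrev Demand (N K : ℕ) : Type := Fin K → Fin N

/-- An `(M, R, F)` caching and delivery code for `N` files of `F` bits each and `K` users. -/
structure Code (N K : ℕ) (M R : ℝ) (F : ℕ) where
  /-- the caching functions: they see the database, but not the demands -/
  cache : Fin K → Database N F → Fin (2 ^ ⌊(F : ℝ) * M⌋₊)
  /-- the coded delivery function, giving the common message -/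
  deliver : Database N F → Demand N K → Fin (2 ^ ⌊(F : ℝ) * R⌋₊)
  /-- the decoding functions -/
  decode : Fin K → Fin (2 ^ ⌊(F : ℝ) * M⌋₊) → Fin (2 ^ ⌊(F : ℝ) * R⌋₊) → Demand N K → Fin (2 ^ F)

variable {N K F : ℕ} {M R : ℝ}

/-- The file that user `k` reconstructs. -/
def Code.output (c : Code N K M R F) (W : Database N F) (d : Demand N K) (k : Fin K) :
    Fin (2 ^ F) :=
  c.decode k (c.cache k W) (c.deliver W d) d

/-- The probability that some user fails to reconstruct its requested file, for the demands `d`;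
the files are independent and uniform, that is, the database is uniform. -/
noncomputable def Code.errorProbAt (c : Code N K M R F) (d : Demand N K) : ℝ :=
  (Nat.card {W : Database N F // ∃ k, c.output W d k ≠ W (d k)} : ℝ) / Nat.card (Database N F)

/-- The probability of error of a code: the maximum over all (finitely many) demands. -/
noncomputable def Code.errorProb (c : Code N K M R F) : ℝ :=
  ⨆ d : Demand N K, c.errorProbAt d

/-- `(M, R)` is achievable if, for every `ε > 0`, there are `(M, R, F)` codes with arbitrarily
large `F` whose probability of error is less than `ε`. -/
def Achievable (N K : ℕ) (M R : ℝ) : Prop :=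
  0 ≤ M ∧ 0 ≤ R ∧
    ∀ ε : ℝ, 0 < ε → ∀ F₀ : ℕ, ∃ F : ℕ, F₀ ≤ F ∧ ∃ c : Code N K M R F, c.errorProb < ε

/-- The function `f(N, K, t)`. -/
noncomputable def f (N K t : ℕ) : ℝ :=
  (((N : ℝ) - 1) * ((K : ℝ) - t)) / (((t : ℝ) + 1) * ((t : ℝ) * N - 1))
    + (N : ℝ) ^ 2 * (1 - 1 / (K : ℝ)) * (((t : ℝ) - 1) / ((t : ℝ) * N - 1))

/-- `t` is a minimizer `t*` of `f(N, K, ·)` over the integers `1, …, K`. The condition `1 < s * N`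
only says that `f(N, K, s)` is defined: it excludes nothing if `N ≥ 2`, and `s = 1` if `N = 1`. -/
def IsOptimal (N K t : ℕ) : Prop :=
  t ∈ {s ∈ Finset.Icc 1 K | 1 < s * N} ∧ ∀ s ∈ {s ∈ Finset.Icc 1 K | 1 < s * N}, f N K t ≤ f N K s

/-- The piecewise linear delivery rate; `T` stands for `max {2, t*}`. It is used for
`1 / K ≤ M ≤ T * N / K`. -/
noncomputable def rateGBC (N K T : ℕ) (M : ℝ) : ℝ :=
  if M ≤ (N : ℝ) / K then
    (N : ℝ) * (1 - M / 2 - 1 / (2 * (K : ℝ)))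
  else
    ((K : ℝ) - T) / ((T : ℝ) ^ 2 - 1) * ((K : ℝ) * M / N - 1)
      + ((K : ℝ) - ((N : ℝ) + 1) / 2) / ((T : ℝ) - 1) * ((T : ℝ) * N / K - M)

end CodedCaching

namespace CodedCaching

/-! The rate is piecewise linear in `M` with corners at `1/K`, `N/K` and `T * N / K`. Each corner is
attained with zero error by a linear code over the two-element field: `exactBits_coded_placement`,
`exactBits_single_placement` and `exactBits_uncoded_placement`. Time-sharing with rational weights
(`ExactPair.combine`) fills in every rational `M`. For real `M` and `R` above the curve, continuity
gives a rational `q ≤ M` whose rate is still at most `R`, and the surplus cache is ignored. -/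

/-! ### Zero-error schemes -/

/-- Caching functions together with, for each demand, a delivery function such that every user's
cache content and the delivered message determine the requested file. -/
def ExactScheme (N K : ℕ) (α β γ : Type) : Prop :=
  ∃ cache : Fin K → (Fin N → α) → β, ∀ d : Demand N K, ∃ deliver : (Fin N → α) → γ,
    ∀ W W' k, cache k W = cache k W' → deliver W = deliver W' → W (d k) = W' (d k)

theorem ExactScheme.map {N K : ℕ} {α β γ α' β' γ' : Type} (h : ExactScheme N K α β γ)
    (e : α' ↪ α) (g : β ↪ β') (j : γ ↪ γ') : ExactScheme N K α' β' γ' := by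
  obtain ⟨cache, h⟩ := h
  refine ⟨fun k W => g (cache k (e ∘ W)), fun d => ?_⟩
  obtain ⟨deliver, h⟩ := h d
  exact ⟨fun W => j (deliver (e ∘ W)), fun W W' k h1 h2 =>
    e.injective (h _ _ k (g.injective h1) (j.injective h2))⟩

theorem ExactScheme.prod {N K : ℕ} {α β γ α' β' γ' : Type} (h : ExactScheme N K α β γ)
    (h' : ExactScheme N K α' β' γ') : ExactScheme N K (α × α') (β × β') (γ × γ') := by
  obtain ⟨cache, h⟩ := h
  obtain ⟨cache', h'⟩ := h'
  refine ⟨fun k W => (cache k (fun n => (W n).1), cache' k (fun n => (W n).2)), fun d => ?_⟩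
  obtain ⟨deliver, h⟩ := h d
  obtain ⟨deliver', h'⟩ := h' d
  refine ⟨fun W => (deliver (fun n => (W n).1), deliver' (fun n => (W n).2)),
    fun W W' k h1 h2 => Prod.ext ?_ ?_⟩
  · exact h _ _ k (congrArg Prod.fst h1) (congrArg Prod.fst h2)
  · exact h' _ _ k (congrArg Prod.snd h1) (congrArg Prod.snd h2)

/-- An exact scheme with files of `a` bits, caches of `m` bits and messages of `r` bits. -/
def ExactBits (N K a m r : ℕ) : Prop :=
  ExactScheme N K (Fin (2 ^ a)) (Fin (2 ^ m)) (Fin (2 ^ r))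

theorem ExactBits.mono {N K a m r m' r' : ℕ} (h : ExactBits N K a m r) (hm : m ≤ m')
    (hr : r ≤ r') : ExactBits N K a m' r' :=
  h.map (.refl _) (Fin.castLEEmb (Nat.pow_le_pow_right two_pos hm))
    (Fin.castLEEmb (Nat.pow_le_pow_right two_pos hr))

theorem ExactBits.add {N K a m r a' m' r' : ℕ} (h : ExactBits N K a m r)
    (h' : ExactBits N K a' m' r') : ExactBits N K (a + a') (m + m') (r + r') := by
  have e : ∀ x y : ℕ, Fin (2 ^ x) × Fin (2 ^ y) ≃ Fin (2 ^ (x + y)) := fun x y =>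
    finProdFinEquiv.trans (finCongr (pow_add 2 x y).symm)
  exact (h.prod h').map (e a a').symm.toEmbedding (e m m').toEmbedding (e r r').toEmbedding

theorem ExactBits.zero (N K : ℕ) : ExactBits N K 0 0 0 :=
  ⟨fun _ _ => 0, fun _ => ⟨fun _ => 0, fun _ _ _ _ _ => Subsingleton.elim (α := Fin 1) _ _⟩⟩

theorem ExactBits.mul {N K a m r : ℕ} (h : ExactBits N K a m r) (s : ℕ) :
    ExactBits N K (s * a) (s * m) (s * r) := by
  induction s with
  | zero => simpa using ExactBits.zero N K
  | succ s ih => simpa only [Nat.succ_mul] using ih.add h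

/-- Additive maps over the two-element field give an exact scheme as soon as, for each user, a
database in the kernel of both the caching and the delivery map has zero requested file. -/
theorem ExactBits.of_additive {N K a m r : ℕ} {ι : Type} [Fintype ι] {κ : Fin K → Type}
    [∀ k, Fintype (κ k)] (cache : ∀ k, (Fin N → ι → ZMod 2) →+ (κ k → ZMod 2))
    (ha : Fintype.card ι = a) (hm : ∀ k, Fintype.card (κ k) ≤ m)
    (h : ∀ d : Demand N K, ∃ (δ : Type) (_ : Fintype δ)
      (deliver : (Fin N → ι → ZMod 2) →+ (δ → ZMod 2)), Fintype.card δ ≤ r ∧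
        ∀ W k, cache k W = 0 → deliver W = 0 → W (d k) = 0) :
    ExactBits N K a m r := by
  classical
  have emb : ∀ (τ : Type) [Fintype τ] (n : ℕ), Fintype.card τ ≤ n →
      Nonempty ((τ → ZMod 2) ↪ Fin (2 ^ n)) := fun τ _ n hn => by
    refine Function.Embedding.nonempty_of_card_le ?_
    simpa using Nat.pow_le_pow_right two_pos hn
  have g := fun k => (emb (κ k) m (hm k)).some
  have e : Fin (2 ^ a) ≃ (ι → ZMod 2) := Fintype.equivOfCardEq (by simp [ha])
  have main : ExactScheme N K (ι → ZMod 2) (Fin (2 ^ m)) (Fin (2 ^ r)) := by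
    refine ⟨fun k W => g k (cache k W), fun d => ?_⟩
    obtain ⟨δ, _, deliver, hr, h⟩ := h d
    have j := (emb δ r hr).some
    refine ⟨fun W => j (deliver W), fun W W' k h1 h2 => ?_⟩
    have h1 := (g k).injective h1
    have h2 := j.injective h2
    simpa [sub_eq_zero] using h (W - W') k (by simp [h1]) (by simp [h2])
  exact main.map e.toEmbedding (.refl _) (.refl _)

/-! ### The three corner schemes -/

/-- Coded placement with the sum of one subfile of each file: cache `1 / K`. -/
theorem exactBits_coded_placement {N K : ℕ} (hN : 1 ≤ N) (hNK : N < K) :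
    ExactBits N K K 1 (N * (K - 1)) := by
  classical
  refine ExactBits.of_additive (ι := Fin K) (κ := fun _ => Unit)
    (fun k => AddMonoidHom.mk' (fun W _ => ∑ n, W n k) fun W W' => ?_) (by simp) (by simp)
    fun d => ?_
  · ext; simp [Finset.sum_add_distrib]
  -- If every file is demanded, choose a leader `u n` for each file `n`. Subfiles of `n` belonging
  -- to users who want another file are sent plainly; those of the other users wanting `n` are
  -- masked by the leader's subfile. A user strips the plain subfiles from its cached sum, gets its
  -- own subfile, then the leader's, then the rest.
  by_cases hd : Function.Surjective d
  · obtain ⟨u, hu⟩ := hd.hasRightInverse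
    refine ⟨Fin N × {k : Fin K // k ≠ ⟨0, by omega⟩}, inferInstance,
      AddMonoidHom.mk' (fun W p =>
        -- The swap indexes the users other than `u p.1` by a set independent of the file.
        let k := Equiv.swap ⟨0, by omega⟩ (u p.1) p.2
        W p.1 k + if p.1 = d k then W p.1 (u p.1) else 0) fun W W' => ?_, ?_, ?_⟩
    · ext p
      dsimp only [Pi.add_apply]
      split_ifs <;> ring
    · simp [Fintype.card_subtype_compl]
    · intro W k hc hX
      have key : ∀ n j, j ≠ u n → W n j + (if n = d j then W n (u n) else 0) = 0 := by
        intro n j hj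
        have := congrFun hX (n, ⟨Equiv.swap ⟨0, by omega⟩ (u n) j, fun h0 => hj ?_⟩)
        · simpa using this
        · rw [Equiv.swap_apply_eq_iff] at h0
          simpa using h0
      have other : ∀ n j, n ≠ d j → W n j = 0 := fun n j hn => by
        simpa [hn] using key n j (fun h => hn (by rw [h, hu]))
      have own : W (d k) k = 0 := by
        have := congrFun hc ()
        simp only [AddMonoidHom.mk'_apply, Pi.zero_apply] at this
        rwa [Finset.sum_eq_single (d k) (fun n _ hn => other n k hn) (by simp)] at this
      have lead : W (d k) (u (d k)) = 0 := by
        by_cases hk : k = u (d k)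
        · rwa [← hk]
        · simpa [own] using key _ _ hk
      ext j
      by_cases hj : j = u (d k)
      · rw [hj]; exact lead
      · simpa [lead] using key _ _ hj
  -- Some file is not demanded: sending the others whole costs `(N - 1) * K ≤ N * (K - 1)`, as `N ≤
  -- K`.
  · simp only [Function.Surjective, not_forall, not_exists] at hd
    obtain ⟨n₀, hn₀⟩ := hd
    refine ⟨{n : Fin N // n ≠ n₀} × Fin K, inferInstance,
      AddMonoidHom.mk' (fun W p => W p.1 p.2) fun W W' => rfl, ?_, fun W k _ hX => ?_⟩
    · simp only [Fintype.card_prod, Fintype.card_subtype_compl, Fintype.card_fin,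
        Fintype.card_unique]
      rw [Nat.sub_mul, Nat.mul_sub]
      omega
    · ext j
      exact congrFun hX (⟨d k, hn₀ k⟩, j)

/-- Uncoded placement of one subfile of each file, with redundant transmissions left out. -/
theorem exactBits_single_placement {N K : ℕ} (hNK : N < K) :
    ExactBits N K K N (K.choose 2 - (K - N).choose 2) := by
  classical
  refine ExactBits.of_additive (ι := Fin K) (κ := fun _ => Fin N)
    (fun k => AddMonoidHom.mk' (fun W n => W n k) fun W W' => rfl) (by simp) (by simp)
    fun d => ?_
  obtain ⟨u, hu⟩ : ∃ u : Fin N → Fin K, ∀ k, d (u (d k)) = d k := by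
    refine ⟨fun n => if h : ∃ k, d k = n then h.choose else ⟨0, by omega⟩, fun k => ?_⟩
    have h : ∃ i, d i = d k := ⟨k, rfl⟩
    simpa only [dif_pos h] using h.choose_spec
  -- `U` contains a leader for each demanded file, padded to exactly `N` users so that the count
  -- does not depend on `d`. Only pairs meeting `U` are sent.
  obtain ⟨U, hU, hUc⟩ : ∃ U : Finset (Fin K), Finset.univ.image u ⊆ U ∧ U.card = N :=
    Finset.exists_superset_card_eq (by simpa using Finset.card_image_le (s := Finset.univ) (f := u))
      (by simpa using hNK.le)
  have huU : ∀ n, u n ∈ U := fun n => hU (by simp)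
  refine ⟨{S // S ∈ Finset.powersetCard 2 (Finset.univ : Finset (Fin K)) \
      Finset.powersetCard 2 Uᶜ}, inferInstance,
    AddMonoidHom.mk' (fun W S => ∑ i ∈ S.1, ∑ j ∈ S.1.erase i, W (d i) j) fun W W' => ?_, ?_, ?_⟩
  · ext S; simp [Finset.sum_add_distrib]
  · rw [Fintype.card_coe, Finset.card_sdiff_of_subset
      (Finset.powersetCard_mono (Finset.subset_univ _))]
    simp [Finset.card_compl, hUc]
  · intro W k hc hX
    have sent : ∀ i j, i ∈ U → W (d i) j + W (d j) i = 0 := by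
      intro i j hi
      rcases eq_or_ne i j with rfl | hij
      · exact CharTwo.add_self_eq_zero _
      have hS : ({i, j} : Finset (Fin K)) ∈ Finset.powersetCard 2 Finset.univ \
          Finset.powersetCard 2 Uᶜ := by
        simp only [Finset.mem_sdiff, Finset.mem_powersetCard, Finset.subset_univ, true_and,
          Finset.card_pair hij, not_and]
        exact fun h => absurd (h (Finset.mem_insert_self i _)) (by simpa using hi)
      have := congrFun hX ⟨_, hS⟩
      simp only [AddMonoidHom.mk'_apply, Pi.zero_apply] at this
      rw [Finset.sum_pair hij, Finset.erase_insert (by simpa using hij), Finset.sum_singleton,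
        Finset.pair_comm, Finset.erase_insert (by simpa using Ne.symm hij),
        Finset.sum_singleton] at this
      exact this
    -- The sum for an unsent pair is a combination of the sums for pairs involving the leaders of
    -- the two requested files.
    have all : ∀ i j, W (d i) j + W (d j) i = 0 := by
      intro i j
      have h1 := sent (u (d i)) j (huU _)
      have h2 := sent (u (d j)) i (huU _)
      have h3 := sent (u (d i)) (u (d j)) (huU _)
      rw [hu] at h1 h2
      rw [hu, hu] at h3
      linear_combination h1 + h2 - h3
    ext j
    have h0 : W (d j) k = 0 := congrFun hc (d j)
    simpa [h0] using all k j

/-- Uncoded placement of the subfiles indexed by the sets of `t` users, and coded multicasting to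
all sets of `t + 1` users. -/
theorem exactBits_uncoded_placement (N K t : ℕ) :
    ExactBits N K (K.choose t) (N * (K - 1).choose (t - 1)) (K.choose (t + 1)) := by
  classical
  refine ExactBits.of_additive (ι := {S : Finset (Fin K) // S.card = t})
    (κ := fun k => Fin N × {S : {S : Finset (Fin K) // S.card = t} // k ∈ S.1})
    (fun k => AddMonoidHom.mk' (fun W p => W p.1 p.2) fun W W' => rfl)
    (by simp) (fun k => ?_) fun d => ?_
  -- Deleting `k` bounds the number of `t`-sets containing `k`. For `t = 0` there are none, while
  -- the truncated binomial is `1`.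
  · rw [Fintype.card_prod, Fintype.card_fin]
    refine Nat.mul_le_mul_left _ ?_
    have hc : (Finset.powersetCard (t - 1) (Finset.univ.erase k)).card
        = (K - 1).choose (t - 1) := by simp
    rw [← hc, ← Fintype.card_coe]
    refine Fintype.card_le_of_injective (fun S => ⟨S.1.1.erase k, ?_⟩) fun S S' h => ?_
    · rw [Finset.mem_powersetCard, Finset.card_erase_of_mem S.2, S.1.2]
      exact ⟨Finset.erase_subset_erase _ (Finset.subset_univ _), rfl⟩
    · have h := congrArg (insert k) (congrArg Subtype.val h)
      simp only [Finset.insert_erase S.2, Finset.insert_erase S'.2] at h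
      exact Subtype.ext (Subtype.ext h)
  · refine ⟨{S : Finset (Fin K) // S.card = t + 1}, inferInstance,
      AddMonoidHom.mk' (fun W S => ∑ i : {i // i ∈ S.1},
        W (d i) ⟨S.1.erase i, by rw [Finset.card_erase_of_mem i.2, S.2]; rfl⟩) fun W W' => ?_,
      by simp, fun W k hc hX => ?_⟩
    · ext S; simp [Finset.sum_add_distrib]
    · ext S
      by_cases hk : k ∈ S.1
      · exact congrFun hc (d k, ⟨S, hk⟩)
      have h := congrFun hX ⟨insert k S.1, by rw [Finset.card_insert_of_notMem hk, S.2]⟩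
      simp only [AddMonoidHom.mk'_apply, Pi.zero_apply] at h
      -- Every other term is indexed by a set still containing `k`, hence is cached by user `k`.
      rw [Finset.sum_eq_single ⟨k, Finset.mem_insert_self k S.1⟩] at h
      · simp only [Finset.erase_insert hk] at h
        exact h
      · intro i _ hi
        refine congrFun hc (d i, ⟨⟨(insert k S.1).erase i, _⟩, ?_⟩)
        exact Finset.mem_erase.2 ⟨fun h => hi (Subtype.ext h.symm), Finset.mem_insert_self _ _⟩
      · simp

/-! ### Memory sharing and achievability -/

/-- Some exact scheme has exactly the cache capacity `M` and the delivery rate `R`. -/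
def ExactPair (N K : ℕ) (M R : ℝ) : Prop :=
  ∃ a m r : ℕ, 0 < a ∧ ExactBits N K a m r ∧ (m : ℝ) = a * M ∧ (r : ℝ) = a * R

theorem ExactBits.exactPair {N K a m r : ℕ} (h : ExactBits N K a m r) (ha : 0 < a) {M R : ℝ}
    (hm : (m : ℝ) = a * M) (hr : (r : ℝ) = a * R) : ExactPair N K M R :=
  ⟨a, m, r, ha, h, hm, hr⟩

theorem ExactPair.rational {N K : ℕ} {M R : ℝ} (h : ExactPair N K M R) : ∃ q : ℚ, (q : ℝ) = M := by
  obtain ⟨a, m, r, ha, -, hm, -⟩ := h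
  refine ⟨m / a, ?_⟩
  push_cast
  rw [hm]
  field_simp

/-- Memory sharing. -/
theorem ExactPair.combine {N K : ℕ} {M R M' R' : ℝ} (h : ExactPair N K M R)
    (h' : ExactPair N K M' R') (θ : ℚ) (h0 : 0 ≤ θ) (h1 : θ ≤ 1) :
    ExactPair N K ((1 - θ) * M + θ * M') ((1 - θ) * R + θ * R') := by
  obtain ⟨a, m, r, ha, h, hm, hr⟩ := h
  obtain ⟨a', m', r', ha', h', hm', hr'⟩ := h'
  obtain ⟨p, s, hq, hθ⟩ : ∃ p s : ℕ, 0 < p + s ∧ (θ : ℝ) * (p + s) = p := by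
    have hp : (θ.num.toNat : ℤ) = θ.num := Int.toNat_of_nonneg (Rat.num_nonneg.2 h0)
    have hle : θ.num.toNat ≤ θ.den := by
      have := Rat.num_le_denom_iff.2 h1
      omega
    refine ⟨θ.num.toNat, θ.den - θ.num.toNat, by have := θ.den_pos; omega, ?_⟩
    rw [Nat.cast_sub hle, add_sub_cancel]
    have : θ * θ.den = θ.num := Rat.mul_den_eq_num θ
    rw [← hp] at this
    exact_mod_cast this
  -- With `θ = p / (p + s)`, these multiplicities give the two schemes file portions in the ratio `s
  -- : p`.
  refine ((h.mul (s * a')).add (h'.mul (p * a))).exactPair (a := s * a' * a + p * a * a') ?_ ?_ ?_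
  · have : s * a' * a + p * a * a' = (p + s) * (a * a') := by ring
    rw [this]
    positivity
  · push_cast
    rw [hm, hm']
    linear_combination (a * a' * (M - M') : ℝ) * hθ
  · push_cast
    rw [hr, hr']
    linear_combination (a * a' * (R - R') : ℝ) * hθ

/-- Repeating an exact scheme on `F₀` blocks gives long files at the same normalized sizes, still
without error. -/
theorem ExactPair.achievable {N K : ℕ} {M R M' R' : ℝ} (h : ExactPair N K M R) (hM : M ≤ M')
    (hR : R ≤ R') : Achievable N K M' R' := by
  obtain ⟨a, m, r, ha, h, hm, hr⟩ := h
  have ha' : (0 : ℝ) < a := by exact_mod_cast ha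
  have hM0 : 0 ≤ M := nonneg_of_mul_nonneg_right (hm ▸ m.cast_nonneg) ha'
  have hR0 : 0 ≤ R := nonneg_of_mul_nonneg_right (hr ▸ r.cast_nonneg) ha'
  refine ⟨hM0.trans hM, hR0.trans hR, fun ε hε F₀ => ⟨F₀ * a, Nat.le_mul_of_pos_right _ ha, ?_⟩⟩
  have h := (h.mul F₀).mono (m' := ⌊((F₀ * a : ℕ) : ℝ) * M'⌋₊) (r' := ⌊((F₀ * a : ℕ) : ℝ) * R'⌋₊)
    (Nat.le_floor (by push_cast; rw [hm, mul_assoc]; gcongr))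
    (Nat.le_floor (by push_cast; rw [hr, mul_assoc]; gcongr))
  obtain ⟨cache, h⟩ := h
  choose deliver h using h
  classical
  let c : Code N K M' R' (F₀ * a) :=
    { cache := cache
      deliver := fun W d => deliver d W
      decode := fun k z x d =>
        -- Any database consistent with cache and message has the right requested file; the default
        -- is never reached on actual outputs.
        if h : ∃ W, cache k W = z ∧ deliver d W = x then h.choose (d k) else ⟨0, by positivity⟩ }
  have hc : ∀ W d k, c.output W d k = W (d k) := fun W d k => by
    have hex : ∃ W', cache k W' = cache k W ∧ deliver d W' = deliver d W := ⟨W, rfl, rfl⟩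
    change dite _ _ _ = _
    rw [dif_pos hex]
    exact h d _ _ k hex.choose_spec.1 hex.choose_spec.2
  refine ⟨c, ?_⟩
  have h0 : ∀ d, c.errorProbAt d = 0 := fun d => by simp [Code.errorProbAt, hc]
  simpa [Code.errorProb, h0] using hε

theorem exactPair_left {N K : ℕ} (hN : 1 ≤ N) (hNK : N < K) :
    ExactPair N K (1 / K) (N - N / K) := by
  have hK : (K : ℝ) ≠ 0 := by norm_cast; omega
  refine (exactBits_coded_placement hN hNK).exactPair (by omega) ?_ ?_
  · field_simp; simp
  · push_cast [Nat.cast_sub (show 1 ≤ K by omega)]; field_simp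

theorem exactPair_middle {N K : ℕ} (hNK : N < K) :
    ExactPair N K (N / K) (N - N * (N + 1) / (2 * K)) := by
  have hK0 : 0 < K := by omega
  have hK : (K : ℝ) ≠ 0 := by positivity
  refine (exactBits_single_placement hNK).exactPair (by omega) ?_ ?_
  · field_simp
  · rw [Nat.cast_sub (Nat.choose_le_choose 2 (Nat.sub_le K N)), Nat.cast_choose_two,
      Nat.cast_choose_two, Nat.cast_sub hNK.le]
    field_simp
    ring

theorem exactPair_right (N : ℕ) {K t : ℕ} (ht : 1 ≤ t) (htK : t ≤ K) :
    ExactPair N K (t * N / K) ((K - t) / (t + 1)) := by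
  have hK : (K : ℝ) ≠ 0 := by norm_cast; omega
  refine (exactBits_uncoded_placement N K t).exactPair (Nat.choose_pos htK) ?_ ?_
  · obtain ⟨s, rfl⟩ := Nat.exists_eq_add_of_le' ht
    obtain ⟨L, rfl⟩ := Nat.exists_eq_add_of_le' (ht.trans htK)
    have h : ((L : ℝ) + 1) * L.choose s = (L + 1).choose (s + 1) * (s + 1) := by
      exact_mod_cast Nat.add_one_mul_choose_eq L s
    push_cast at hK ⊢
    field_simp
    linear_combination (N : ℝ) * h
  · have h : (K.choose (t + 1) : ℝ) * (t + 1) = K.choose t * (K - t) := by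
      rw [← Nat.cast_sub htK]
      exact_mod_cast Nat.choose_succ_right_eq K t
    rw [← mul_div_assoc, ← h]
    field_simp

theorem exists_rat_convex {x y M : ℝ} (hx : ∃ q : ℚ, (q : ℝ) = x) (hy : ∃ q : ℚ, (q : ℝ) = y)
    (hM : ∃ q : ℚ, (q : ℝ) = M) (h1 : x ≤ M) (h2 : M ≤ y) :
    ∃ θ : ℚ, 0 ≤ θ ∧ θ ≤ 1 ∧ M = (1 - θ) * x + θ * y := by
  obtain ⟨x, rfl⟩ := hx
  obtain ⟨y, rfl⟩ := hy
  obtain ⟨M, rfl⟩ := hM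
  norm_cast at h1 h2
  rcases (h1.trans h2).eq_or_lt with rfl | hxy
  · exact ⟨0, le_rfl, zero_le_one, by simp [le_antisymm h2 h1]⟩
  · have : y - x ≠ 0 := (sub_pos.2 hxy).ne'
    refine ⟨(M - x) / (y - x), div_nonneg (by linarith) (by linarith),
      (div_le_one (by linarith)).2 (by linarith), ?_⟩
    norm_cast
    field_simp
    ring

theorem exactPair_rateGBC {N K T : ℕ} (hN : 1 ≤ N) (hNK : N < K) (hT : 2 ≤ T) (hTK : T ≤ K)
    {M : ℝ} (hM : 1 / (K : ℝ) ≤ M) (hM' : M ≤ (T : ℝ) * N / K) (hq : ∃ q : ℚ, (q : ℝ) = M) :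
    ExactPair N K M (rateGBC N K T M) := by
  have hK : (K : ℝ) ≠ 0 := by norm_cast; omega
  have hN0 : (N : ℝ) ≠ 0 := by norm_cast; omega
  have p₁ := exactPair_left hN hNK
  have p₂ := exactPair_middle hNK
  have p₃ := exactPair_right N (show 1 ≤ T by omega) hTK
  unfold rateGBC
  split_ifs with h
  · obtain ⟨θ, h0, h1, rfl⟩ := exists_rat_convex p₁.rational p₂.rational hq hM h
    convert p₁.combine p₂ θ h0 h1 using 1
    field_simp
    ring
  · obtain ⟨θ, h0, h1, rfl⟩ := exists_rat_convex p₂.rational p₃.rational hq (not_le.1 h).le hM'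
    convert p₂.combine p₃ θ h0 h1 using 1
    have hT' : (2 : ℝ) ≤ T := by exact_mod_cast hT
    have h3 : (T : ℝ) - 1 ≠ 0 := by linarith
    have h4 : (T : ℝ) + 1 ≠ 0 := by linarith
    have h5 : (T : ℝ) ^ 2 - 1 = (T - 1) * (T + 1) := by ring
    rw [h5]
    field_simp
    ring

theorem continuous_rateGBC {N K T : ℕ} (hN : 1 ≤ N) (hNK : N < K) (hT : 2 ≤ T) :
    Continuous (rateGBC N K T) := by
  unfold rateGBC
  refine Continuous.if_le (by fun_prop) (by fun_prop) continuous_id continuous_const ?_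
  rintro M rfl
  have hK : (K : ℝ) ≠ 0 := by norm_cast; omega
  have hN0 : (N : ℝ) ≠ 0 := by norm_cast; omega
  have hT' : (2 : ℝ) ≤ T := by exact_mod_cast hT
  have h3 : (T : ℝ) - 1 ≠ 0 := by linarith
  field_simp
  ring

end CodedCaching

theorem corollary2 (N K : ℕ) (hN : 1 ≤ N) (hNK : N < K)
    (t : ℕ) (ht : CodedCaching.IsOptimal N K t)
    (M : ℝ) (hM : 1 / (K : ℝ) ≤ M) (hM' : M ≤ ((max 2 t : ℕ) : ℝ) * (N : ℝ) / (K : ℝ)) :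
    ((∃ q : ℚ, (q : ℝ) = M) →
        CodedCaching.Achievable N K M (CodedCaching.rateGBC N K (max 2 t) M)) ∧
      ∀ R : ℝ, CodedCaching.rateGBC N K (max 2 t) M < R → CodedCaching.Achievable N K M R := by
  have hT : 2 ≤ max 2 t := le_max_left _ _
  have hTK : max 2 t ≤ K := by
    have := (Finset.mem_Icc.1 (Finset.mem_filter.1 ht.1).1).2
    omega
  have exact_at : ∀ q : ℚ, 1 / (K : ℝ) ≤ q → (q : ℝ) ≤ M → CodedCaching.ExactPair N K q _ :=
    fun q h1 h2 => CodedCaching.exactPair_rateGBC hN hNK hT hTK h1 (h2.trans hM') ⟨q, rfl⟩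
  refine ⟨?_, fun R hR => ?_⟩
  · rintro ⟨q, rfl⟩
    exact (exact_at q hM le_rfl).achievable le_rfl le_rfl
  -- At `M = 1/K` there is no room for a smaller rational, but `M` itself is rational.
  · rcases hM.eq_or_lt with h | h
    · have hq : (((1 / K : ℚ)) : ℝ) = M := by push_cast; exact h
      refine (exact_at (1 / K) (hM.trans_eq hq.symm) hq.le).achievable hq.le ?_
      rw [hq]
      exact hR.le
    · obtain ⟨l, hl, hlM⟩ := exists_Ioc_subset_of_mem_nhds
        ((CodedCaching.continuous_rateGBC hN hNK hT).continuousAt.eventually_lt_const hR) ⟨_, h⟩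
      obtain ⟨q, hq1, hq2⟩ := exists_rat_btwn (max_lt hl h)
      exact (exact_at q ((le_max_right _ _).trans hq1.le) hq2.le).achievable hq2.le
        (hlM ⟨(le_max_left _ _).trans_lt hq1, hq2.le⟩).le
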